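/- Let $G$ be a (finite-dimensional real, smooth) Lie group with Lie algebra $\mathfrak g$ of left invariant vector fields. The tangent bundle $TG$ is a Lie group with the product $v\cdot w = T_hL_g\,w + T_gR_h\,v$ for $v\in T_gG$, $w\in T_hG$. For a vector field $X$ on $G$ let $X^v$ be the vertical lift of $X$, the vector field on $TG$ whose value at $y\in T_xG$ is the velocity at $t=0$ of the curve $t\mapsto y+tX(x)$, and let $X^c$ be the complete lift of $X$, whose value at $y \in T_xG$ is the velocity at $t=0$ of the curve $t\mapsto T\varphi_t(y)$, where $\varphi_t$ is the (local) flow of $X$. For left invariant Riemannian metrics $g^1,g^2$ on $G$, a lift of $(g^1,g^2)$ to $TG$ is a left invariant Riemannian metric $\tilde g$ on $TG$ such that, for all $X,Y\in\mathfrak g$, $$\tilde g(X^c,Y^c)=g^1(X,Y),\qquad \tilde g(X^v,Y^v)=g^2(X,Y),\qquad \tilde g(X^c,Y^v)=0,$$ where the functions $g^i(X,Y)$ on $G$ are regarded as functions on $TG$ through the projection $TG\to G$. The group $G$ is called indecomposable if $\mathfrak g$ is not the direct sum of two Lie algebras of smaller dimension. Theorem. Let $G$ be a connected and indecomposable Lie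 group and let $g^1$, $g^2$ be left invariant Riemannian metrics on $G$. Suppose that $g^1$ is bi-invariant and that $$g^2([Z,[X,Y]],W)=0\qquad\text{for all } X,Y,Z,W\in\mathfrak g .$$ Then the lift $\tilde g$ of $(g^1,g^2)$ to $TG$ exists, is unique, and is a bi-invariant Riemannian metric on the Lie group $TG$. -/

import Mathlib

open Set Filter Bundle VectorField
open scoped Manifold Topology ContDiff

/-! ### The tangent group of a Lie group -/

section TangentGroup

variable {E : Type*} [NormedAddCommGroup E] [NormedSpace ℝ E]
  {H : Type*} [TopologicalSpace H] {I : ModelWithCorners ℝ E H}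
  {G : Type*} [TopologicalSpace G] [ChartedSpace H G]

theorem tangentBundle_mk_congr {x y : G} (h : x = y) (u v : E) (h' : u = v) :
    (⟨x, u⟩ : TangentBundle I G) = ⟨y, v⟩ := by
  subst h h'; rfl

theorem mfderiv_comp_val {E' : Type*} [NormedAddCommGroup E'] [NormedSpace ℝ E']
    {H' : Type*} [TopologicalSpace H'] {J : ModelWithCorners ℝ E' H'}
    {N : Type*} [TopologicalSpace N] [ChartedSpace H' N]
    {f : G → N} {g : N → G} {k : G → G} {x : G} (hk : ∀ y, g (f y) = k y)
    (hg : MDifferentiableAt J I g (f x)) (hf : MDifferentiableAt I J f x) (u : E) :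
    (mfderiv J I g (f x) (mfderiv I J f x u : E') : E) = (mfderiv I I k x u : E) := by
  have e : k = g ∘ f := funext fun y => (hk y).symm
  subst e
  rw [mfderiv_comp x hg hf]
  rfl

variable [Group G]

/-- The product on `TG` induced by the product `μ` of `G`: for `v ∈ T_g G` and `w ∈ T_h G`,
`v * w = Tμ (v, w) = T_h L_g w + T_g R_h v ∈ T_{gh} G`. -/
noncomputable instance tangentMul : Mul (TangentBundle I G) where
  mul p q := ⟨p.proj * q.proj,
    mfderiv I I (fun x : G => p.proj * x) q.proj q.snd +
      mfderiv I I (fun x : G => x * q.proj) p.proj p.snd⟩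

/-- The neutral element of `TG` is the zero vector `0_e ∈ T_e G`. -/
noncomputable instance tangentOne : One (TangentBundle I G) where
  one := ⟨1, (0 : TangentSpace I (1 : G))⟩

/-- The inverse in `TG` is the tangent map of the inversion of `G`. -/
noncomputable instance tangentInv : Inv (TangentBundle I G) where
  inv p := tangentMap I I (fun x : G => x⁻¹) p

theorem tangent_mul_def (p q : TangentBundle I G) :
    p * q = ⟨p.proj * q.proj,
      mfderiv I I (fun x : G => p.proj * x) q.proj q.snd +
        mfderiv I I (fun x : G => x * q.proj) p.proj p.snd⟩ := rfl

theorem tangent_one_def :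
    (1 : TangentBundle I G) = ⟨1, (0 : TangentSpace I (1 : G))⟩ := rfl

theorem tangent_inv_def (p : TangentBundle I G) :
    p⁻¹ = tangentMap I I (fun x : G => x⁻¹) p := rfl

theorem tangent_one_mul (p : TangentBundle I G) : 1 * p = p := by
  obtain ⟨a, u⟩ := p
  simp only [tangent_mul_def, tangent_one_def]
  refine tangentBundle_mk_congr (one_mul a) _ _ ?_
  have h : (fun x : G => 1 * x) = id := funext one_mul
  rw [map_zero, add_zero, h, mfderiv_id]
  rfl

theorem tangent_mul_one (p : TangentBundle I G) : p * 1 = p := by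
  obtain ⟨a, u⟩ := p
  simp only [tangent_mul_def, tangent_one_def]
  refine tangentBundle_mk_congr (mul_one a) _ _ ?_
  have h : (fun x : G => x * 1) = id := funext mul_one
  rw [map_zero, zero_add, h, mfderiv_id]
  rfl

variable [LieGroup I ∞ G]

instance lieGroup_minSmoothness : LieGroup I (minSmoothness ℝ 3) G := by
  rw [minSmoothness_of_isRCLikeNormedField]
  infer_instance

theorem mdiff_mul_left (g x : G) : MDifferentiableAt I I (fun y : G => g * y) x :=
  (contMDiff_mul_left (I := I) (n := ∞) (a := g)).mdifferentiableAt (by simp)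

theorem mdiff_mul_right (g x : G) : MDifferentiableAt I I (fun y : G => y * g) x :=
  (contMDiff_mul_right (I := I) (n := ∞) (a := g)).mdifferentiableAt (by simp)

/-- The product of `TG` is the tangent map of the product of `G`, under the identification
`T(G × G) = TG × TG`. -/
theorem tangent_mul_eq (p q : TangentBundle I G) :
    p * q = tangentMap (I.prod I) I (fun z : G × G => z.1 * z.2)
      ((equivTangentBundleProd I G I G).symm (p, q)) := by
  have h : MDifferentiableAt (I.prod I) I (fun z : G × G => z.1 * z.2) (p.proj, q.proj) :=
    (contMDiff_mul I ∞).mdifferentiableAt (by simp)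
  rw [tangent_mul_def]
  simp only [tangentMap, equivTangentBundleProd]
  refine congrArg (TotalSpace.mk (F := E) (p.proj * q.proj)) ?_
  have := mfderiv_prod_eq_add_apply
    (v := ((p.snd, q.snd) : TangentSpace (I.prod I) (p.proj, q.proj))) h
  rw [add_comm]
  exact this.symm

theorem tangent_mul_assoc (p q r : TangentBundle I G) : p * q * r = p * (q * r) := by
  obtain ⟨a, u⟩ := p
  obtain ⟨b, v⟩ := q
  obtain ⟨c, w⟩ := r
  simp only [tangent_mul_def]
  refine tangentBundle_mk_congr (mul_assoc a b c) _ _ ?_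
  have hA : (mfderiv I I (fun x : G => a * x) (b * c) (mfderiv I I (fun x : G => b * x) c w : E) : E)
      = (mfderiv I I (fun x : G => a * b * x) c w : E) :=
    mfderiv_comp_val (E := E) (E' := E) (fun y => (mul_assoc a b y).symm) (mdiff_mul_left a _) (mdiff_mul_left b c) w
  have hB : (mfderiv I I (fun x : G => x * c) (a * b) (mfderiv I I (fun x : G => a * x) b v : E) : E)
      = (mfderiv I I (fun x : G => a * x * c) b v : E) :=
    mfderiv_comp_val (E := E) (E' := E) (fun y => rfl) (mdiff_mul_right c _) (mdiff_mul_left a b) v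
  have hB' : (mfderiv I I (fun x : G => a * x) (b * c) (mfderiv I I (fun x : G => x * c) b v : E) : E)
      = (mfderiv I I (fun x : G => a * x * c) b v : E) :=
    mfderiv_comp_val (E := E) (E' := E) (fun y => (mul_assoc a y c).symm) (mdiff_mul_left a _) (mdiff_mul_right c b) v
  have hC : (mfderiv I I (fun x : G => x * c) (a * b) (mfderiv I I (fun x : G => x * b) a u : E) : E)
      = (mfderiv I I (fun x : G => x * (b * c)) a u : E) :=
    mfderiv_comp_val (E := E) (E' := E) (fun y => mul_assoc y b c) (mdiff_mul_right c _) (mdiff_mul_right b a) u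
  rw [map_add, map_add]
  change (mfderiv I I (fun x : G => a * b * x) c w : E) +
      ((mfderiv I I (fun x : G => x * c) (a * b) (mfderiv I I (fun x : G => a * x) b v : E) : E) +
       (mfderiv I I (fun x : G => x * c) (a * b) (mfderiv I I (fun x : G => x * b) a u : E) : E)) =
     ((mfderiv I I (fun x : G => a * x) (b * c) (mfderiv I I (fun x : G => b * x) c w : E) : E) +
      (mfderiv I I (fun x : G => a * x) (b * c) (mfderiv I I (fun x : G => x * c) b v : E) : E)) +
     (mfderiv I I (fun x : G => x * (b * c)) a u : E)
  rw [hA, hB, hB', hC]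
  exact (add_assoc (G := E) _ _ _).symm

theorem tangent_inv_mul_cancel (p : TangentBundle I G) : p⁻¹ * p = 1 := by
  obtain ⟨a, u⟩ := p
  have hi : MDifferentiableAt I I (fun x : G => x⁻¹) a :=
    (contMDiff_inv I ∞).mdifferentiableAt (by simp)
  have hd : MDifferentiableAt I (I.prod I) (fun x : G => (x⁻¹, x)) a :=
    hi.prodMk mdifferentiableAt_id
  have hm : MDifferentiableAt (I.prod I) I (fun z : G × G => z.1 * z.2) (a⁻¹, a) :=
    (contMDiff_mul I ∞).mdifferentiableAt (by simp)
  have hc : (mfderiv (I.prod I) I (fun z : G × G => z.1 * z.2) (a⁻¹, a)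
      (mfderiv I (I.prod I) (fun x : G => (x⁻¹, x)) a u : E × E) : E) =
      (mfderiv I I (fun _ : G => (1 : G)) a u : E) :=
    mfderiv_comp_val (E := E) (E' := E × E) (f := fun x : G => (x⁻¹, x))
      (fun y => inv_mul_cancel y) hm hd u
  have hp : mfderiv I (I.prod I) (fun x : G => (x⁻¹, x)) a =
      (mfderiv I I (fun x : G => x⁻¹) a).prod (mfderiv I I (fun x : G => x) a) :=
    mfderiv_prodMk hi mdifferentiableAt_id
  have hid : mfderiv I I (fun x : G => x) a = ContinuousLinearMap.id ℝ (TangentSpace I a) :=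
    mfderiv_id
  rw [hp, hid, mfderiv_const] at hc
  rw [tangent_mul_eq, tangent_one_def]
  simp only [tangent_inv_def, tangentMap, equivTangentBundleProd]
  exact tangentBundle_mk_congr (inv_mul_cancel a) _ _ hc

/-- The group structure of `TG`. -/
noncomputable instance tangentGroup : Group (TangentBundle I G) where
  mul_assoc := tangent_mul_assoc
  one_mul := tangent_one_mul
  mul_one := tangent_mul_one
  inv_mul_cancel := tangent_inv_mul_cancel

/-- `TG` is a Lie group. -/
instance tangentLieGroup : LieGroup I.tangent ∞ (TangentBundle I G) where
  contMDiff_mul := by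
    have h : (fun p : TangentBundle I G × TangentBundle I G => p.1 * p.2) =
        tangentMap (I.prod I) I (fun z : G × G => z.1 * z.2) ∘
          (equivTangentBundleProd I G I G).symm := by
      funext p; exact tangent_mul_eq p.1 p.2
    rw [h]
    exact ((contMDiff_mul I ∞).contMDiff_tangentMap (m := ∞) (by simp)).comp
      contMDiff_equivTangentBundleProd_symm
  contMDiff_inv := (contMDiff_inv I ∞).contMDiff_tangentMap (m := ∞) (by simp)

end TangentGroup

/-! ### Lifts of vector fields to the tangent bundle -/

section Lifts

variable {E : Type*} [NormedAddCommGroup E] [NormedSpace ℝ E]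
  {H : Type*} [TopologicalSpace H] {I : ModelWithCorners ℝ E H}
  {M : Type*} [TopologicalSpace M] [ChartedSpace H M]

/-- The velocity `c'(0)` of a curve `c` in `M` with `c 0 = p`, as a tangent vector at `p`. -/
noncomputable def velocityAt (p : M) (c : ℝ → M) : TangentSpace I p :=
  (mfderiv 𝓘(ℝ, ℝ) I c 0 (1 : ℝ) : E)

/-- `φ` is a local flow of the vector field `X` near `x`: for some `ε > 0` and all `y` near `x`,
the curve `t ↦ φ t y`, `|t| < ε`, is an integral curve of `X` which starts at `y`. -/
def IsLocalFlowAt (X : Π y : M, TangentSpace I y) (x : M) (φ : ℝ → M → M) : Prop :=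
  ∃ ε > (0 : ℝ), ∀ᶠ y in 𝓝 x,
    φ 0 y = y ∧ IsMIntegralCurveOn (fun t => φ t y) X (Ioo (-ε) ε)

variable [IsManifold I 1 M]

/-- The vertical lift `X^v`: at `y ∈ T_x M` it is the velocity at `t = 0` of the
curve `t ↦ y + t X(x)` in `T_x M ⊆ TM`. -/
noncomputable def verticalLift (X : Π y : M, TangentSpace I y) (p : TangentBundle I M) :
    TangentSpace I.tangent p :=
  velocityAt p fun t : ℝ => (⟨p.proj, p.snd + t • X p.proj⟩ : TangentBundle I M)

open Classical in
/-- The complete lift `X^c`: at `y ∈ T_x M` it is the velocity at `t = 0` of the curve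
`t ↦ Tφ_t (y)` in `TM`, where `φ` is the flow of `X` near `x`. (On a Hausdorff manifold without
boundary, the local flow of a smooth vector field exists and its germ is unique, so that the
result does not depend on the choice of `φ`; the value `0` is given only if there is no flow.) -/
noncomputable def completeLift (X : Π y : M, TangentSpace I y) (p : TangentBundle I M) :
    TangentSpace I.tangent p :=
  if h : ∃ φ : ℝ → M → M, IsLocalFlowAt X p.proj φ then
    velocityAt p fun t : ℝ => tangentMap I I (h.choose t) p
  else 0

end Lifts

/-! ### Invariant Riemannian metrics -/

section Metrics

variable {E : Type*} [NormedAddCommGroup E] [NormedSpace ℝ E]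
  {H : Type*} [TopologicalSpace H] {I : ModelWithCorners ℝ E H}
  {G : Type*} [TopologicalSpace G] [ChartedSpace H G] [Group G] [LieGroup I ∞ G]

/-- Smooth Riemannian metrics on a manifold. -/
abbrev SmoothMetric {E : Type*} [NormedAddCommGroup E] [NormedSpace ℝ E]
    {H : Type*} [TopologicalSpace H] (I : ModelWithCorners ℝ E H)
    (M : Type*) [TopologicalSpace M] [ChartedSpace H M] [IsManifold I 1 M] :=
  ContMDiffRiemannianMetric I ∞ E (TangentSpace I : M → Type _)

/-- All left translations are isometries. -/
def IsLeftInvariantMetric (g : SmoothMetric I G) : Prop :=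
  ∀ (a x : G) (u w : TangentSpace I x),
    g.inner (a * x) (mfderiv I I (fun y : G => a * y) x u) (mfderiv I I (fun y : G => a * y) x w) =
      g.inner x u w

/-- All right translations are isometries. -/
def IsRightInvariantMetric (g : SmoothMetric I G) : Prop :=
  ∀ (a x : G) (u w : TangentSpace I x),
    g.inner (x * a) (mfderiv I I (fun y : G => y * a) x u) (mfderiv I I (fun y : G => y * a) x w) =
      g.inner x u w

/-- A Riemannian metric is bi-invariant if it is left invariant and right invariant. -/
def IsBiInvariantMetric (g : SmoothMetric I G) : Prop :=
  IsLeftInvariantMetric g ∧ IsRightInvariantMetric g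

/-- `g'` is the lift of `g₁` and `g₂` to `TG`: the left invariant Riemannian metric on the Lie
group `TG` with `g'(X^c, Y^c) = g₁(X, Y)`, `g'(X^v, Y^v) = g₂(X, Y)` and `g'(X^c, Y^v) = 0` for all
left invariant vector fields `X`, `Y` on `G`. Here `mulInvariantVectorField X` is the left invariant
vector field with value `X` at the neutral element. -/
structure IsLiftedMetric (g₁ g₂ : SmoothMetric I G)
    (g' : SmoothMetric I.tangent (TangentBundle I G)) : Prop where
  leftInvariant : IsLeftInvariantMetric g'
  complete_complete : ∀ (X Y : GroupLieAlgebra I G) (p : TangentBundle I G),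
    g'.inner p (completeLift (mulInvariantVectorField X) p)
        (completeLift (mulInvariantVectorField Y) p) =
      g₁.inner p.proj (mulInvariantVectorField X p.proj) (mulInvariantVectorField Y p.proj)
  vertical_vertical : ∀ (X Y : GroupLieAlgebra I G) (p : TangentBundle I G),
    g'.inner p (verticalLift (mulInvariantVectorField X) p)
        (verticalLift (mulInvariantVectorField Y) p) =
      g₂.inner p.proj (mulInvariantVectorField X p.proj) (mulInvariantVectorField Y p.proj)
  complete_vertical : ∀ (X Y : GroupLieAlgebra I G) (p : TangentBundle I G),
    g'.inner p (completeLift (mulInvariantVectorField X) p)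
        (verticalLift (mulInvariantVectorField Y) p) = 0

end Metrics

/-- A Lie group is indecomposable if its Lie algebra is not the direct sum of two Lie algebras
(that is, of two ideals) of smaller dimension. -/
def IsIndecomposableLieGroup {E : Type*} [NormedAddCommGroup E] [NormedSpace ℝ E]
    {H : Type*} [TopologicalSpace H] (I : ModelWithCorners ℝ E H)
    (G : Type*) [TopologicalSpace G] [ChartedSpace H G] [Group G] [LieGroup I ∞ G]
    [FiniteDimensional ℝ E] : Prop :=
  haveI : CompleteSpace E := FiniteDimensional.complete ℝ E
  ¬ ∃ 𝔞 𝔟 : LieIdeal ℝ (GroupLieAlgebra I G), IsCompl 𝔞 𝔟 ∧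
    Module.finrank ℝ 𝔞 < Module.finrank ℝ (GroupLieAlgebra I G) ∧
    Module.finrank ℝ 𝔟 < Module.finrank ℝ (GroupLieAlgebra I G)

/-!
The lift exists and is unique for any left invariant `g₁`, `g₂`, because complete and vertical
lifts of left invariant vector fields are again left invariant: the flow of a left invariant `X` is
right translation by the integral curve `γ` of `X` through `1`, so that `X^c` at `p` is the velocity
of `t ↦ p * 0_{γ t}`, while `X^v` at `p` is the velocity of `t ↦ p * (t X)`, with `t X ∈ T_1 G`
(`completeLift_mulInvariantVectorField`, `verticalLift_mulInvariantVectorField`). In the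
identification `T_1 (TG) = E × E` their values at the neutral element are `(X, 0)` and `(0, X)`.
The lift is therefore the left invariant metric on `TG` with value
`g₁ (u.1, v.1) + g₂ (u.2, v.2)` at the neutral element (`isLiftedMetric_liftMetric`), and it is
determined by its values on left invariant fields (`IsLiftedMetric.unique`).

For the bi-invariance, `g₂` being definite, the hypothesis says that all brackets `⁅Z, ⁅X, Y⁆⁆`
vanish. Since `g₁` is bi-invariant, `Ad` preserves `g₁` at `1`, and differentiating gives
`g₁ (⁅X, Y⁆, Z) + g₁ (X, ⁅Z, Y⁆) = 0` (`inner_lie_add_inner_lie`). With `Z = ⁅X, Y⁆` this yields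
`⁅X, Y⁆ = 0` (`lie_eq_zero_of_biInvariant`): a nilpotent Lie algebra with a bi-invariant metric is
abelian. Then `Ad` has zero derivative, hence is trivial on the connected group `G`, and in turn all
maps `x ↦ a x a⁻¹ x⁻¹` have zero derivative (`mul_comm_of_lie_eq_zero`). So `G` is abelian, hence
`TG` is abelian, and left and right invariance of a metric on `TG` mean the same.

The link between `Ad` and the Lie bracket, `⁅v, w⁆ = d/dw (a ↦ Ad_{a⁻¹} v)` at `1`
(`lie_eq_mfderiv_adInv`), is a computation in the chart at `1`, based on the symmetry of the second
derivative of the product.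
-/

/-! ### Left invariant metrics and the Maurer–Cartan form -/

section LeftInvariant

variable {E : Type*} [NormedAddCommGroup E] [NormedSpace ℝ E]
  {H : Type*} [TopologicalSpace H] {I : ModelWithCorners ℝ E H}
  {G : Type*} [TopologicalSpace G] [ChartedSpace H G] [Group G] [LieGroup I ∞ G]

variable (I) in
/-- The left Maurer–Cartan form: it translates a vector at `p` back to the neutral element. It is the
derivative at `p` of `q ↦ p⁻¹ * q`, whose target `T_{p⁻¹ p} G` is identified with `T_1 G` because both
are `E` by definition. -/
noncomputable def maurerCartan (p : G) : TangentSpace I p →L[ℝ] GroupLieAlgebra I G :=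
  (mfderiv I I (fun q : G => p⁻¹ * q) p : E →L[ℝ] E)

theorem maurerCartan_mfderiv_mul_left (a p : G) (u : TangentSpace I p) :
    maurerCartan I (a * p) (mfderiv I I (fun q : G => a * q) p u : E) = maurerCartan I p u :=
  mfderiv_comp_val (E := E) (E' := E) (k := fun q => p⁻¹ * q) (fun q => by group)
    (mdiff_mul_left _ _) (mdiff_mul_left a p) u

theorem maurerCartan_mulInvariantVectorField (v : GroupLieAlgebra I G) (p : G) :
    maurerCartan I p (mulInvariantVectorField v p) = v := by
  have h : (mfderiv I I (fun q : G => p⁻¹ * q) (p * 1)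
      (mfderiv I I (fun q : G => p * q) 1 v : E) : E) = (mfderiv I I (id : G → G) 1 v : E) :=
    mfderiv_comp_val (E := E) (E' := E) (fun q => by simp)
      (mdiff_mul_left _ _) (mdiff_mul_left p 1) v
  rw [mfderiv_id, mul_one] at h
  exact h

/-- Left invariant vector fields span every tangent space. -/
theorem mulInvariantVectorField_maurerCartan (p : G) (u : TangentSpace I p) :
    mulInvariantVectorField (maurerCartan I p u) p = u := by
  have h : (mfderiv I I (fun q : G => p * q) (p⁻¹ * p)
      (mfderiv I I (fun q : G => p⁻¹ * q) p u : E) : E) = (mfderiv I I (id : G → G) p u : E) :=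
    mfderiv_comp_val (E := E) (E' := E) (fun q => by simp)
      (mdiff_mul_left _ _) (mdiff_mul_left p⁻¹ p) u
  rw [mfderiv_id, inv_mul_cancel] at h
  exact h

theorem mfderiv_mul_left_mulInvariantVectorField (a p : G) (v : GroupLieAlgebra I G) :
    (mfderiv I I (fun q : G => a * q) p (mulInvariantVectorField v p) : E) =
      (mulInvariantVectorField v (a * p) : E) := by
  have h : (mfderiv I I (fun q : G => a * q) (p * 1)
      (mfderiv I I (fun q : G => p * q) 1 v : E) : E) =
      (mfderiv I I (fun q : G => a * p * q) 1 v : E) :=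
    mfderiv_comp_val (E := E) (E' := E) (fun q => by simp [mul_assoc])
      (mdiff_mul_left _ _) (mdiff_mul_left p 1) v
  rw [mul_one] at h
  exact h

theorem inner_mulInvariantVectorField {g : SmoothMetric I G} (hg : IsLeftInvariantMetric g)
    (v w : GroupLieAlgebra I G) (p : G) :
    g.inner p (mulInvariantVectorField v p) (mulInvariantVectorField w p) = g.inner 1 v w := by
  have h := hg p 1 v w
  rw [mul_one] at h
  exact h

omit [Group G] [LieGroup I ∞ G] in
/-- The trivialization of the tangent bundle at `x` is the identity on the fibre over `x`. -/
theorem trivializationAt_tangent_self [IsManifold I 1 G] (x : G) (v : E) :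
    ((trivializationAt E (TangentSpace I : G → Type _) x).continuousLinearMapAt ℝ x v : E) = v := by
  rw [TangentBundle.continuousLinearMapAt_trivializationAt_eq_core (mem_chart_source H x)]
  exact (tangentBundleCore I G).coordChange_self (achart H x) x (mem_chart_source H x) v

/-- The Maurer–Cartan form, read in the trivialization of the tangent bundle at `p₀`, is smooth. -/
theorem contMDiffAt_maurerCartan (p₀ : G) :
    ContMDiffAt I 𝓘(ℝ, E →L[ℝ] E) ∞
      (fun p : G => (ContinuousLinearMap.comp (σ₁₂ := RingHom.id ℝ) (M₂ := E)
        (maurerCartan I p : E →L[ℝ] E)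
        ((trivializationAt E (TangentSpace I) p₀).symmL ℝ p : E →L[ℝ] E) : E →L[ℝ] E)) p₀ := by
  have h := ContMDiffAt.mfderiv (I := I) (I' := I) (n := ∞) (m := ∞) (x₀ := p₀)
    (fun p q : G => p⁻¹ * q) id
    (((contMDiff_fst.inv).mul contMDiff_snd).contMDiffAt) contMDiffAt_id (by simp)
  refine h.congr_of_eventuallyEq ?_
  filter_upwards with p
  simp only [inTangentCoordinates, id, inv_mul_cancel]
  -- The base point equals the one wanted only propositionally, so it is generalized and substituted.
  have key : ∀ q : G, q = 1 → ∀ w : E,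
      ((trivializationAt E (TangentSpace I : G → Type _) 1).continuousLinearMapAt ℝ q w : E) = w := by
    rintro q rfl w
    exact trivializationAt_tangent_self 1 w
  ext v
  exact (key _ (inv_mul_cancel p) _).symm

variable (I) in
/-- The left invariant field of bilinear forms on `G` with value `B` on `T_1 G = E`. -/
noncomputable def leftInvariantForm (B : E →L[ℝ] E →L[ℝ] ℝ)
    (p : G) : TangentSpace I p →L[ℝ] TangentSpace I p →L[ℝ] ℝ :=
  (B.bilinearComp (maurerCartan I p : E →L[ℝ] E) (maurerCartan I p : E →L[ℝ] E) :
    E →L[ℝ] E →L[ℝ] ℝ)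

omit [LieGroup I ∞ G] in
theorem leftInvariantForm_apply (B : E →L[ℝ] E →L[ℝ] ℝ) (p : G) (u v : TangentSpace I p) :
    leftInvariantForm I B p u v = B (maurerCartan I p u : E) (maurerCartan I p v : E) := rfl

theorem contMDiff_leftInvariantForm (B : E →L[ℝ] E →L[ℝ] ℝ) :
    ContMDiff I (I.prod 𝓘(ℝ, E →L[ℝ] E →L[ℝ] ℝ)) ∞
      (fun p : G => TotalSpace.mk' (E →L[ℝ] E →L[ℝ] ℝ)
        (E := fun p : G => TangentSpace I p →L[ℝ] TangentSpace I p →L[ℝ] ℝ) p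
        (leftInvariantForm I B p)) := by
  intro p₀
  rw [contMDiffAt_hom_bundle]
  refine ⟨contMDiffAt_id, ?_⟩
  have h := contMDiffAt_maurerCartan (I := I) p₀
  have h2 := (h.clm_precomp (F₃ := ℝ)).clm_comp ((contMDiffAt_const (c := B)).clm_comp h)
  refine h2.congr_of_eventuallyEq ?_
  have hb : (trivializationAt E (TangentSpace I) p₀).baseSet ∈ 𝓝 p₀ :=
    (trivializationAt E (TangentSpace I) p₀).open_baseSet.mem_nhds
      (FiberBundle.mem_baseSet_trivializationAt' p₀)
  filter_upwards [hb] with p hp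
  ext u v
  rw [inCoordinates_apply_eq₂ hp hp (Set.mem_univ _)]
  simp only [leftInvariantForm_apply, ← Trivialization.symmL_apply (R := ℝ) _ hp,
    Bundle.Trivial.fiberBundle_trivializationAt', Bundle.Trivial.linearMapAt_trivialization]
  rfl

/-- The left invariant Riemannian metric with value `B` on `T_1 G = E`. -/
noncomputable def leftInvariantMetric (B : E →L[ℝ] E →L[ℝ] ℝ) (hsymm : ∀ u v, B u v = B v u)
    (hpos : ∀ v, v ≠ 0 → 0 < B v v) (hbdd : Bornology.IsVonNBounded ℝ {v | B v v < 1}) :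
    SmoothMetric I G where
  inner p := leftInvariantForm I B p
  symm p u v := hsymm _ _
  pos p v hv := by
    refine hpos _ fun h0 => hv ?_
    rw [← mulInvariantVectorField_maurerCartan p v]
    exact (congrArg (fun w : GroupLieAlgebra I G => mulInvariantVectorField w p) h0).trans
      (map_zero (mfderiv I I (fun q : G => p * q) 1))
  isVonNBounded p := by
    refine (hbdd.image (mfderiv I I (fun q : G => p * q) 1 : E →L[ℝ] E)).subset ?_
    intro v hv
    exact ⟨maurerCartan I p v, hv, mulInvariantVectorField_maurerCartan p v⟩
  contMDiff := contMDiff_leftInvariantForm B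

theorem isLeftInvariantMetric_leftInvariantMetric (B : E →L[ℝ] E →L[ℝ] ℝ)
    (hsymm : ∀ u v, B u v = B v u)
    (hpos : ∀ v, v ≠ 0 → 0 < B v v) (hbdd : Bornology.IsVonNBounded ℝ {v | B v v < 1}) :
    IsLeftInvariantMetric (leftInvariantMetric (I := I) (G := G) B hsymm hpos hbdd) := by
  intro a p u w
  change B (maurerCartan I (a * p) _ : E) (maurerCartan I (a * p) _ : E) =
    B (maurerCartan I p u : E) (maurerCartan I p w : E)
  exact congrArg₂ (fun x y : E => B x y) (maurerCartan_mfderiv_mul_left a p u)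
    (maurerCartan_mfderiv_mul_left a p w)

theorem inner_leftInvariantMetric (B : E →L[ℝ] E →L[ℝ] ℝ)
    (hsymm : ∀ u v, B u v = B v u)
    (hpos : ∀ v, v ≠ 0 → 0 < B v v) (hbdd : Bornology.IsVonNBounded ℝ {v | B v v < 1})
    (v w : GroupLieAlgebra I G) (p : G) :
    (leftInvariantMetric (I := I) (G := G) B hsymm hpos hbdd).inner p
      (mulInvariantVectorField v p) (mulInvariantVectorField w p) = B v w :=
  congrArg₂ (fun x y : E => B x y) (maurerCartan_mulInvariantVectorField v p)
    (maurerCartan_mulInvariantVectorField w p)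

/-- A metric is determined by its values on left invariant vector fields. -/
theorem smoothMetric_ext_of_mulInvariant {g g' : SmoothMetric I G}
    (h : ∀ (v w : GroupLieAlgebra I G) (p : G),
      g.inner p (mulInvariantVectorField v p) (mulInvariantVectorField w p) =
      g'.inner p (mulInvariantVectorField v p) (mulInvariantVectorField w p)) : g = g' := by
  have : g.inner = g'.inner := by
    funext p
    ext u w
    rw [← mulInvariantVectorField_maurerCartan p u, ← mulInvariantVectorField_maurerCartan p w]
    exact h _ _ p
  cases g
  cases g'
  subst this
  rfl

theorem isBiInvariantMetric_of_comm {g : SmoothMetric I G} (hg : IsLeftInvariantMetric g)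
    (hc : ∀ x y : G, x * y = y * x) : IsBiInvariantMetric g := by
  refine ⟨hg, fun a x u w => ?_⟩
  have h : (fun y : G => y * a) = fun y => a * y := funext fun y => hc y a
  rw [h, hc x a]
  exact hg a x u w

end LeftInvariant

/-! ### Lifts of left invariant vector fields -/

section LiftsOfInvariantFields

variable {E : Type*} [NormedAddCommGroup E] [NormedSpace ℝ E]
  {H : Type*} [TopologicalSpace H] {I : ModelWithCorners ℝ E H}
  {G : Type*} [TopologicalSpace G] [ChartedSpace H G] [Group G] [LieGroup I ∞ G]

/-- A curve `t ↦ p * c t` with `c 0 = 1` has the left translate of `c'(0)` as its velocity. -/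
theorem velocityAt_mul_left (p : G) {c : ℝ → G} (hc0 : c 0 = 1)
    (hc : MDifferentiableAt 𝓘(ℝ, ℝ) I c 0) :
    (velocityAt (I := I) p (fun t => p * c t) : E) =
      (mulInvariantVectorField (velocityAt (I := I) 1 c) p : E) := by
  -- The base point equals the one wanted only propositionally, so it is generalized and substituted.
  have key : ∀ y : G, c 0 = y → ∀ w : E, (mfderiv I I (fun q : G => p * q) (c 0) w : E) =
      (mfderiv I I (fun q : G => p * q) y w : E) := by
    rintro y rfl w; rfl
  have h := mfderiv_comp (I := 𝓘(ℝ, ℝ)) (I' := I) (I'' := I) (0 : ℝ)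
    (mdiff_mul_left (I := I) p (c 0)) hc
  have h1 : (mfderiv 𝓘(ℝ, ℝ) I (fun t => p * c t) 0 (1 : ℝ) : E) =
      (mfderiv I I (fun q : G => p * q) (c 0) (mfderiv 𝓘(ℝ, ℝ) I c 0 (1 : ℝ)) : E) :=
    congrArg (fun L : ℝ →L[ℝ] E => L 1) h
  exact h1.trans (key 1 hc0 _)

theorem trivializationAt_tangent_mk_self (x : G) (w : E) :
    trivializationAt E (TangentSpace I) x (⟨x, w⟩ : TangentBundle I G) = (x, w) := by
  refine Prod.ext rfl ?_
  have h := Trivialization.coe_linearMapAt_of_mem (R := ℝ)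
    (trivializationAt E (TangentSpace I : G → Type _) x)
    (FiberBundle.mem_baseSet_trivializationAt' x)
  exact (congrFun h w).symm.trans (trivializationAt_tangent_self x w)

/-- The velocity of the line `t ↦ t X` in the fibre `T_1 G` is the vector `(0, X)` of `E × E`. -/
theorem hasMFDerivAt_vertical_line (X : E) :
    HasMFDerivAt 𝓘(ℝ, ℝ) I.tangent
      (fun t : ℝ => (⟨1, (t • X : E)⟩ : TangentBundle I G)) 0
      ((ContinuousLinearMap.inr ℝ E E).comp ((1 : ℝ →L[ℝ] ℝ).smulRight X) : ℝ →L[ℝ] E × E) := by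
  have hd : HasFDerivAt (fun t : ℝ => ((extChartAt I (1 : G) 1, t • X) : E × E))
      ((ContinuousLinearMap.inr ℝ E E).comp ((1 : ℝ →L[ℝ] ℝ).smulRight X) : ℝ →L[ℝ] E × E) 0 := by
    refine ((hasFDerivAt_const (extChartAt I (1 : G) 1) (0 : ℝ)).prodMk
      ((hasFDerivAt_id (𝕜 := ℝ) (0 : ℝ)).smul_const X)).congr_fderiv ?_
    ext <;> simp
  refine ⟨?_, ?_⟩
  · refine ContMDiffAt.continuousAt (I := 𝓘(ℝ, ℝ)) (I' := I.tangent) (n := ∞) ?_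
    rw [contMDiffAt_totalSpace]
    refine ⟨contMDiffAt_const, ?_⟩
    simp only [trivializationAt_tangent_mk_self]
    exact (contDiff_id.smul contDiff_const).contMDiff.contMDiffAt
  · refine (hd.congr_of_eventuallyEq ?_).hasFDerivWithinAt
    filter_upwards with t
    rw [writtenInExtChartAt, FiberBundle.extChartAt]
    simp only [mfld_simps, trivializationAt_tangent_mk_self]
    rfl

omit [LieGroup I ∞ G] in
theorem mfderiv_mul_one_right (x : G) (u : TangentSpace I x) :
    (mfderiv I I (fun y : G => y * 1) x u : E) = u := by
  have h : (fun y : G => y * 1) = id := funext mul_one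
  rw [h, mfderiv_id]
  rfl

theorem tangent_mul_mk_one (p : TangentBundle I G) (w : E) :
    p * (⟨1, w⟩ : TangentBundle I G) =
      ⟨p.proj, (p.snd + mulInvariantVectorField (w : GroupLieAlgebra I G) p.proj :
        TangentSpace I p.proj)⟩ := by
  rw [tangent_mul_def]
  refine tangentBundle_mk_congr (mul_one _) _ _ ?_
  refine (add_comm (G := E) _ _).trans ?_
  exact congrArg₂ (fun a b : E => a + b) (mfderiv_mul_one_right p.proj p.snd) rfl

omit [LieGroup I ∞ G] in
theorem tangent_mul_mk_zero (p : TangentBundle I G) (a : G) :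
    p * (⟨a, (0 : E)⟩ : TangentBundle I G) =
      ⟨p.proj * a, mfderiv I I (fun x : G => x * a) p.proj p.snd⟩ := by
  rw [tangent_mul_def]
  refine tangentBundle_mk_congr rfl _ _ ?_
  refine Eq.trans ?_ (zero_add (M := E) _)
  exact congrArg₂ (fun a b : E => a + b)
    (map_zero (mfderiv I I (fun x : G => p.proj * x) a)) rfl

omit [LieGroup I ∞ G] in
theorem mulInvariantVectorField_one (X : GroupLieAlgebra I G) :
    mulInvariantVectorField X (1 : G) = X := by
  have h : (fun q : G => 1 * q) = id := funext one_mul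
  rw [mulInvariantVectorField, h, mfderiv_id]
  rfl

/-- The vertical lift of the left invariant field `X` is the left invariant field `(0, X)` on `TG`. -/
theorem verticalLift_mulInvariantVectorField (X : GroupLieAlgebra I G) (p : TangentBundle I G) :
    verticalLift (mulInvariantVectorField X) p =
      mulInvariantVectorField (I := I.tangent) (G := TangentBundle I G)
        ((0, X) : E × E) p := by
  have hι := hasMFDerivAt_vertical_line (I := I) (G := G) X
  have hc : (fun t : ℝ => (⟨p.proj, p.snd + t • mulInvariantVectorField X p.proj⟩ :
      TangentBundle I G)) = fun t => p * (⟨1, (t • X : E)⟩ : TangentBundle I G) := by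
    funext t
    refine Eq.trans ?_ (tangent_mul_mk_one p _).symm
    refine tangentBundle_mk_congr rfl _ _ ?_
    refine congrArg (fun a : TangentSpace I p.proj => p.snd + a) ?_
    exact (map_smul (mfderiv I I (fun x : G => p.proj * x) 1) t X).symm
  have h0 : (⟨1, ((0 : ℝ) • X : E)⟩ : TangentBundle I G) = 1 :=
    tangentBundle_mk_congr rfl _ _ (zero_smul ℝ X)
  have h2 : (velocityAt (I := I.tangent) 1
      (fun t : ℝ => (⟨1, (t • X : E)⟩ : TangentBundle I G)) : E × E) = (0, X) := by
    refine (congrArg (fun L : ℝ →L[ℝ] E × E => L 1) hι.mfderiv).trans ?_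
    exact Prod.ext rfl (one_smul ℝ X)
  rw [verticalLift, hc]
  exact (velocityAt_mul_left p h0 hι.mdifferentiableAt).trans
    (congrArg (fun w : E × E => (mulInvariantVectorField (I := I.tangent)
      (G := TangentBundle I G) w p : E × E)) h2)

variable [CompleteSpace E] [BoundarylessManifold I G] [T2Space G]

omit [CompleteSpace E] [BoundarylessManifold I G] [T2Space G] in
theorem IsMIntegralCurveOn.mul_left {γ : ℝ → G} {X : GroupLieAlgebra I G} {s : Set ℝ}
    (hγ : IsMIntegralCurveOn γ (mulInvariantVectorField X) s) (y : G) :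
    IsMIntegralCurveOn (fun t => y * γ t) (mulInvariantVectorField X) s := by
  intro t ht
  have h := (mdiff_mul_left (I := I) y (γ t)).hasMFDerivAt.comp_hasMFDerivWithinAt t (hγ t ht)
  have e : (mfderiv I I (fun q : G => y * q) (γ t)).comp
      ((1 : ℝ →L[ℝ] ℝ).smulRight (mulInvariantVectorField X (γ t))) =
      ((1 : ℝ →L[ℝ] ℝ).smulRight (mulInvariantVectorField X (y * γ t) : E)) := by
    ext
    simp [← mfderiv_mul_left_mulInvariantVectorField y (γ t) X]
  exact h.congr_mfderiv e

/-- The complete lift of the left invariant field `X` is the left invariant field `(X, 0)` on `TG`. Any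
local flow of `X` is right translation by the integral curve through `1`, by uniqueness of integral
curves. -/
theorem completeLift_mulInvariantVectorField (X : GroupLieAlgebra I G) (p : TangentBundle I G) :
    completeLift (mulInvariantVectorField X) p =
      mulInvariantVectorField (I := I.tangent) (G := TangentBundle I G)
        ((X, 0) : E × E) p := by
  have hV : ContMDiff I I.tangent 1
      (fun x : G => (⟨x, mulInvariantVectorField X x⟩ : TangentBundle I G)) := by
    refine (contMDiff_mulInvariantVectorField X).of_le ?_
    simp [minSmoothness_of_isRCLikeNormedField]
  obtain ⟨γ, hγ0, hγ⟩ := exists_isMIntegralCurveAt_of_contMDiffAt_boundaryless (t₀ := 0)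
    (hV.contMDiffAt (x := 1))
  obtain ⟨ε, hε, hγε⟩ := isMIntegralCurveAt_iff'.1 hγ
  rw [Real.ball_eq_Ioo, zero_sub, zero_add] at hγε
  have hex : ∃ φ : ℝ → G → G, IsLocalFlowAt (mulInvariantVectorField X) p.proj φ :=
    ⟨fun t y => y * γ t, ε, hε, Eventually.of_forall fun y =>
      ⟨by simp [hγ0], hγε.mul_left y⟩⟩
  have hγd := hγ.hasMFDerivAt
  rw [completeLift, dif_pos hex]
  obtain ⟨ε', hε', hφ⟩ := hex.choose_spec
  set φ := hex.choose
  have heq : ∀ t ∈ Ioo (-(min ε ε')) (min ε ε'), (φ t) =ᶠ[𝓝 p.proj] fun y => y * γ t := by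
    intro t ht
    filter_upwards [hφ] with y hy
    have hs : ∀ {δ}, min ε ε' ≤ δ → Ioo (-(min ε ε')) (min ε ε') ⊆ Ioo (-δ) δ := fun h =>
      Ioo_subset_Ioo (neg_le_neg h) h
    refine isMIntegralCurveOn_Ioo_eqOn_of_contMDiff_boundaryless (t₀ := 0) ?_ hV
      (hy.2.mono (hs (min_le_right _ _))) ((hγε.mul_left y).mono (hs (min_le_left _ _))) ?_ ht
    · simp [hε, hε']
    · simp [hy.1, hγ0]
  let ζ : G → TangentBundle I G := zeroSection E (TangentSpace I)
  have hζ : ContMDiff I I.tangent ∞ ζ := Bundle.contMDiff_zeroSection ℝ (TangentSpace I : G → Type _)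
  have hcurve : (fun t : ℝ => tangentMap I I (φ t) p) =ᶠ[𝓝 0] fun t => p * ζ (γ t) := by
    have : Ioo (-(min ε ε')) (min ε ε') ∈ 𝓝 (0 : ℝ) :=
      Ioo_mem_nhds (by simp [hε, hε']) (by simp [hε, hε'])
    filter_upwards [this] with t ht
    refine Eq.trans ?_ (tangent_mul_mk_zero p (γ t)).symm
    refine tangentBundle_mk_congr (heq t ht).eq_of_nhds _ _ ?_
    rw [(heq t ht).mfderiv_eq]
    rfl
  have hc0 : (ζ ∘ γ) 0 = 1 := by simp [ζ, hγ0]; rfl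
  have hζγ := ((hζ.mdifferentiableAt (x := γ 0) (by simp)).hasMFDerivAt).comp (0 : ℝ) hγd
  have h1 : (velocityAt p (fun t : ℝ => tangentMap I I (φ t) p) : E × E) =
      velocityAt p (fun t => p * (ζ ∘ γ) t) :=
    congrArg (fun L : ℝ →L[ℝ] E × E => L 1)
      (Filter.EventuallyEq.mfderiv_eq (I := 𝓘(ℝ, ℝ)) (I' := I.tangent) hcurve)
  -- The base point equals the one wanted only propositionally, so it is generalized and substituted.
  have key : ∀ y : G, y = 1 → (mfderiv I I.tangent ζ y (mulInvariantVectorField X y) : E × E) =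
      (X, 0) := by
    rintro y rfl
    rw [mulInvariantVectorField_one]
    have h := TangentBundle.tangentMap_tangentBundle_pure (I := I) (⟨1, X⟩ : TangentBundle I G)
    exact eq_of_heq (TotalSpace.mk.inj h).2
  have h2 : (velocityAt (I := I.tangent) 1 (ζ ∘ γ) : E × E) = (X, 0) := by
    refine (congrArg (fun L : ℝ →L[ℝ] E × E => L 1) hζγ.mfderiv).trans ?_
    refine Eq.trans ?_ (key _ hγ0)
    exact congrArg (mfderiv I I.tangent ζ (γ 0)) (one_smul ℝ (mulInvariantVectorField X (γ 0)))
  exact h1.trans ((velocityAt_mul_left p hc0 hζγ.mdifferentiableAt).trans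
    (congrArg (fun w : E × E => (mulInvariantVectorField (I := I.tangent)
      (G := TangentBundle I G) w p : E × E)) h2))

end LiftsOfInvariantFields

/-! ### Maps with vanishing derivative -/

section Constancy

/-- A map with vanishing derivative on a connected manifold without boundary is constant. -/
theorem eq_of_mfderiv_eq_zero {E : Type*} [NormedAddCommGroup E] [NormedSpace ℝ E]
    {H : Type*} [TopologicalSpace H] {I : ModelWithCorners ℝ E H} [I.Boundaryless]
    {M : Type*} [TopologicalSpace M] [ChartedSpace H M] [IsManifold I 1 M] [ConnectedSpace M]
    {E' : Type*} [NormedAddCommGroup E'] [NormedSpace ℝ E']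
    {H' : Type*} [TopologicalSpace H'] {J : ModelWithCorners ℝ E' H'}
    {N : Type*} [TopologicalSpace N] [ChartedSpace H' N] [IsManifold J 1 N]
    {f : M → N} (hf : MDifferentiable I J f) (h : ∀ x, mfderiv I J f x = 0) (x y : M) :
    f x = f y := by
  have hloc : IsLocallyConstant f := by
    rw [IsLocallyConstant.iff_eventually_eq]
    intro x
    set φ := extChartAt I x with hφ
    set ψ := extChartAt J (f x) with hψ
    have hU : ∀ᶠ z in 𝓝 (φ x), z ∈ φ.target ∧ f (φ.symm z) ∈ ψ.source := by
      refine Filter.Eventually.and (extChartAt_target_mem_nhds (I := I) x) ?_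
      have hc : ContinuousAt (f ∘ φ.symm) (φ x) := by
        refine ContinuousAt.comp ?_ (continuousAt_extChartAt_symm x)
        exact (hf _).continuousAt
      refine hc.preimage_mem_nhds ?_
      simp only [Function.comp, hφ, extChartAt_to_inv]
      exact extChartAt_source_mem_nhds (f x)
    obtain ⟨r, hr, hball⟩ := Metric.eventually_nhds_iff_ball.1 hU
    have hd : ∀ z ∈ Metric.ball (φ x) r, HasFDerivAt (ψ ∘ f ∘ φ.symm) (0 : E →L[ℝ] E') z := by
      intro z hz
      obtain ⟨hz1, hz2⟩ := hball z hz
      have h1 : MDifferentiableAt 𝓘(ℝ, E) I φ.symm z :=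
        (mdifferentiableOn_extChartAt_symm z hz1).mdifferentiableAt
          ((isOpen_extChartAt_target x).mem_nhds hz1)
      have h2 : HasMFDerivAt I J f (φ.symm z) 0 := by
        rw [← h]; exact (hf _).hasMFDerivAt
      have h3 : MDifferentiableAt J 𝓘(ℝ, E') ψ (f (φ.symm z)) :=
        mdifferentiableAt_extChartAt (by rwa [hψ, extChartAt_source] at hz2)
      have h4 := h3.hasMFDerivAt.comp z (h2.comp z h1.hasMFDerivAt)
      rw [ContinuousLinearMap.zero_comp, ContinuousLinearMap.comp_zero] at h4
      exact h4.hasFDerivAt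
    have hconst : ∀ z ∈ Metric.ball (φ x) r, (ψ ∘ f ∘ φ.symm) z = (ψ ∘ f ∘ φ.symm) (φ x) :=
      fun z hz => Metric.isOpen_ball.is_const_of_fderiv_eq_zero (𝕜 := ℝ)
        (convex_ball _ _).isPreconnected
        (fun w hw => (hd w hw).differentiableAt.differentiableWithinAt)
        (fun w hw => (hd w hw).fderiv) hz (Metric.mem_ball_self hr)
    have hev : ∀ᶠ y in 𝓝 x, φ y ∈ Metric.ball (φ x) r :=
      (continuousAt_extChartAt x).preimage_mem_nhds (Metric.ball_mem_nhds _ hr)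
    filter_upwards [hev, extChartAt_source_mem_nhds (I := I) x] with y hy hys
    have h1 := hconst _ hy
    have h2 := (hball _ hy).2
    simp only [Function.comp, hφ, extChartAt_to_inv, (extChartAt I x).left_inv hys] at h1 h2
    exact ψ.injOn h2 (mem_extChartAt_source _) h1
  exact hloc.apply_eq_of_isPreconnected isPreconnected_univ (mem_univ _) (mem_univ _)

end Constancy

/-! ### The Lie bracket of translation fields in a vector space -/

section Calculus

/-- The model computation for the Lie bracket. Here `F` is a product near its neutral element `e`; the
vector `A x` is the right translate of `A e` to `x`, translated back to `e` from the left. The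
derivatives of `F (x, y)` in `x` and in `y` may be exchanged, which is what identifies the bracket of
the left invariant fields of `A e` and `w` with the derivative of `A`. -/
theorem lieBracket_eq_fderiv_of_translation {E : Type*} [NormedAddCommGroup E] [NormedSpace ℝ E]
    {F : E × E → E} {e : E} (hF : ContDiffAt ℝ 2 F (e, e))
    (h₂ : ∀ u : E, fderiv ℝ F (e, e) (0, u) = u) {A : E → E} (hA : DifferentiableAt ℝ A e)
    (hAF : ∀ᶠ x in 𝓝 e, fderiv ℝ F (e, x) (A e, 0) = fderiv ℝ F (x, e) (0, A x)) (w : E) :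
    lieBracket ℝ (fun x => fderiv ℝ F (x, e) (0, A e)) (fun x => fderiv ℝ F (x, e) (0, w)) e =
      fderiv ℝ A e w := by
  have hd : DifferentiableAt ℝ (fderiv ℝ F) (e, e) :=
    (hF.fderiv_right (m := 1) (by norm_num)).differentiableAt (by simp)
  set S := fderiv ℝ (fderiv ℝ F) (e, e) with hS
  have hsymm : ∀ u v, S u v = S v u := (hF.isSymmSndFDerivAt (by simp)).eq
  have hL : HasFDerivAt (fun x : E => fderiv ℝ F (x, e)) (S.comp (.inl ℝ E E)) e :=
    hd.hasFDerivAt.comp (f := fun x : E => (x, e)) e (hasFDerivAt_prodMk_left e e)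
  have hR : HasFDerivAt (fun x : E => fderiv ℝ F (e, x)) (S.comp (.inr ℝ E E)) e :=
    hd.hasFDerivAt.comp (f := fun x : E => (e, x)) e (hasFDerivAt_prodMk_right e e)
  have hLc : ∀ c u : E, fderiv ℝ (fun x => fderiv ℝ F (x, e) (0, c)) e u = S (u, 0) (0, c) := by
    intro c u
    rw [(hL.clm_apply (hasFDerivAt_const ((0, c) : E × E) e)).fderiv]
    simp
  have hA' : HasFDerivAt (fun x => ((0, A x) : E × E))
      ((ContinuousLinearMap.inr ℝ E E).comp (fderiv ℝ A e)) e :=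
    (ContinuousLinearMap.inr ℝ E E).hasFDerivAt.comp e hA.hasFDerivAt
  have h1 := (hL.clm_apply hA').congr_of_eventuallyEq hAF
  have h3 := (hR.clm_apply (hasFDerivAt_const ((A e, 0) : E × E) e)).unique h1
  have h4 := congrArg (fun L : E →L[ℝ] E => L w) h3
  simp [h₂] at h4
  rw [lieBracket_eq]
  simp only [hLc, h₂]
  rw [hsymm (A e, 0), h4]
  abel

end Calculus

/-! ### The adjoint action -/

section Adjoint

variable {E : Type*} [NormedAddCommGroup E] [NormedSpace ℝ E]
  {H : Type*} [TopologicalSpace H] {I : ModelWithCorners ℝ E H}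
  {G : Type*} [TopologicalSpace G] [ChartedSpace H G] [Group G] [LieGroup I ∞ G]

variable (I) in
/-- The zero vector at `a`, as an element of the group `TG`. -/
noncomputable def zeroVec (a : G) : TangentBundle I G := ⟨a, (0 : E)⟩

theorem contMDiff_zeroVec : ContMDiff I I.tangent ∞ (zeroVec I : G → TangentBundle I G) :=
  Bundle.contMDiff_zeroSection ℝ (TangentSpace I : G → Type _)

theorem zeroVec_mul (a b : G) : zeroVec I (a * b) = zeroVec I a * zeroVec I b := by
  refine Eq.trans ?_ (tangent_mul_mk_zero _ b).symm
  exact tangentBundle_mk_congr (E := E) (I := I) rfl _ _ (map_zero (mfderiv I I (fun x : G => x * b) a)).symm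

variable (I) in
/-- The conjugate `0_a⁻¹ * v * 0_a` in `TG` of a vector `v ∈ T_1 G`. It lies in `T_1 G` again, but its
base point is `a⁻¹ * (1 * a)`. -/
noncomputable def adInvVec (v : E) (a : G) : TangentBundle I G :=
  (zeroVec I a)⁻¹ * ((⟨1, v⟩ : TangentBundle I G) * zeroVec I a)

variable (I) in
/-- `Ad_{a⁻¹} v`, as an element of `T_1 G = E`. -/
noncomputable def adInv (v : E) (a : G) : E := (adInvVec I v a).snd

omit [LieGroup I ∞ G] in
theorem adInvVec_eq (v : E) (a : G) : adInvVec I v a = (⟨1, (adInv I v a : E)⟩ : TangentBundle I G) := by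
  have h : (adInvVec I v a).proj = 1 := by
    change a⁻¹ * (1 * a) = 1
    simp
  exact tangentBundle_mk_congr (E := E) (I := I) h _ _ rfl

theorem adInv_mul (v : E) (a b : G) : adInv I v (a * b) = adInv I (adInv I v a) b := by
  have h : adInvVec I v (a * b) = adInvVec I (adInv I v a) b := by
    rw [adInvVec, adInvVec, ← adInvVec_eq (I := I) v a, zeroVec_mul, adInvVec]
    group
  simp only [adInv] at h ⊢
  rw [h]

theorem adInv_one (v : E) : adInv I v (1 : G) = v := by
  have h : adInvVec I v (1 : G) = (⟨1, v⟩ : TangentBundle I G) := by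
    have h1 : zeroVec I (1 : G) = 1 := rfl
    rw [adInvVec, h1]
    simp
  rw [adInvVec_eq] at h
  exact eq_of_heq (TotalSpace.mk.inj h).2

/-- The defining property of the adjoint action: the left translate of `Ad_{a⁻¹} v` to `a` is the right
translate of `v`. -/
theorem mulInvariantVectorField_adInv (v : E) (a : G) :
    (mulInvariantVectorField (I := I) (adInv (E := E) I v a : GroupLieAlgebra I G) a : E) =
      (mfderiv I I (fun x : G => x * a) 1 v : E) := by
  have h : zeroVec I a * adInvVec I v a = (⟨1, v⟩ : TangentBundle I G) * zeroVec I a := by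
    rw [adInvVec]; group
  rw [adInvVec_eq] at h
  replace h := ((tangent_mul_mk_one (zeroVec I a) _).symm.trans h).trans
    (tangent_mul_mk_zero (I := I) (⟨1, v⟩ : TangentBundle I G) a)
  have h2 := eq_of_heq (TotalSpace.mk.inj (h.trans
    (tangentBundle_mk_congr (E := E) (I := I) (one_mul a) _ (mfderiv I I (fun x : G => x * a) 1 v : E) rfl))).2
  exact (zero_add (M := E) _).symm.trans h2

theorem contMDiff_adInv (v : E) : ContMDiff I 𝓘(ℝ, E) ∞ (adInv I v : G → E) := by
  have hc : ContMDiff I I.tangent ∞ (adInvVec I v : G → TangentBundle I G) :=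
    contMDiff_zeroVec.inv.mul (contMDiff_const.mul contMDiff_zeroVec)
  intro a
  have h := (contMDiffAt_totalSpace.1 (hc a)).2
  simpa only [adInvVec_eq, trivializationAt_tangent_mk_self] using h

variable [I.Boundaryless]

variable (I G) in
/-- The product of `G` in the chart at `1`. -/
noncomputable def chartMul (z : E × E) : E :=
  extChartAt I (1 : G) ((extChartAt I (1 : G)).symm z.1 * (extChartAt I (1 : G)).symm z.2)

theorem contDiffAt_chartMul {x y : E} (hx : x ∈ (extChartAt I (1 : G)).target)
    (hy : y ∈ (extChartAt I (1 : G)).target)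
    (hxy : (extChartAt I (1 : G)).symm x * (extChartAt I (1 : G)).symm y ∈ (chartAt H (1 : G)).source) :
    ContDiffAt ℝ ∞ (chartMul I G) (x, y) := by
  rw [← contMDiffAt_iff_contDiffAt, modelWithCornersSelf_prod, ← chartedSpaceSelf_prod]
  have hs : ∀ {z}, z ∈ (extChartAt I (1 : G)).target →
      ContMDiffAt 𝓘(ℝ, E) I ∞ (extChartAt I (1 : G)).symm z := fun hz =>
    (contMDiffOn_extChartAt_symm (1 : G)).contMDiffAt ((isOpen_extChartAt_target (1 : G)).mem_nhds hz)
  have h1 := (hs hx).comp (x, y) (contMDiffAt_fst (I := 𝓘(ℝ, E)) (J := 𝓘(ℝ, E)) (n := ∞) (p := (x, y)))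
  have h2 := (hs hy).comp (x, y) (contMDiffAt_snd (I := 𝓘(ℝ, E)) (J := 𝓘(ℝ, E)) (n := ∞) (p := (x, y)))
  have h3 := h1.mul h2
  have h4 := (contMDiffAt_extChartAt' (I := I) (n := ∞) hxy).comp (x, y) h3
  exact h4

end Adjoint

/-! ### The Lie bracket as the derivative of the adjoint action -/

section Bracket

variable {E : Type*} [NormedAddCommGroup E] [NormedSpace ℝ E]
  {H : Type*} [TopologicalSpace H] {I : ModelWithCorners ℝ E H} [I.Boundaryless]
  {G : Type*} [TopologicalSpace G] [ChartedSpace H G] [Group G] [LieGroup I ∞ G]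

omit [Group G] [LieGroup I ∞ G] in
theorem hasMFDerivAt_extChartAt_symm_self [IsManifold I 1 G] (x : G) :
    HasMFDerivAt 𝓘(ℝ, E) I (extChartAt I x).symm (extChartAt I x x)
      (ContinuousLinearMap.id ℝ E : E →L[ℝ] E) := by
  have h1 : MDifferentiableAt 𝓘(ℝ, E) I (extChartAt I x).symm (extChartAt I x x) :=
    (mdifferentiableOn_extChartAt_symm _ (mem_extChartAt_target x)).mdifferentiableAt
      (extChartAt_target_mem_nhds x)
  have h2 := mfderivWithin_range_extChartAt_symm (I := I) (x := x)
  rw [I.range_eq_univ, mfderivWithin_univ] at h2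
  exact h1.hasMFDerivAt.congr_mfderiv h2

/-- In the chart at `1` a map `f` has the derivative `T_1 f`, followed by the derivative of the chart
at `f 1`: the derivative of the inverse chart at its centre is the identity. -/
theorem hasFDerivAt_chart_comp {f : G → G} {a : G} (hf : MDifferentiableAt I I f 1) (ha : f 1 = a)
    (has : a ∈ (chartAt H (1 : G)).source) :
    HasFDerivAt (extChartAt I (1 : G) ∘ f ∘ (extChartAt I (1 : G)).symm)
      (ContinuousLinearMap.comp (M₂ := E) (σ₁₂ := RingHom.id ℝ)
        (mfderiv I 𝓘(ℝ, E) (extChartAt I (1 : G)) a : E →L[ℝ] E) (mfderiv I I f 1 : E →L[ℝ] E) :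
        E →L[ℝ] E) (extChartAt I (1 : G) 1) := by
  have h1 : ∀ b, b = 1 → HasMFDerivAt I I f b (mfderiv I I f 1 : E →L[ℝ] E) := by
    rintro b rfl; exact hf.hasMFDerivAt
  have h2 : ∀ b, b = a → HasMFDerivAt I 𝓘(ℝ, E) (extChartAt I (1 : G)) b
      (mfderiv I 𝓘(ℝ, E) (extChartAt I (1 : G)) a : E →L[ℝ] E) := by
    rintro b rfl; exact (mdifferentiableAt_extChartAt has).hasMFDerivAt
  have h3 := hasMFDerivAt_extChartAt_symm_self (I := I) (1 : G)
  have e1 : (extChartAt I (1 : G)).symm (extChartAt I (1 : G) 1) = 1 := extChartAt_to_inv 1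
  have h4 := (h1 _ e1).comp (extChartAt I (1 : G) 1) h3
  have h5 := (h2 ((f ∘ (extChartAt I (1 : G)).symm) (extChartAt I (1 : G) 1))
    (by rw [Function.comp, e1, ha])).comp (extChartAt I (1 : G) 1) h4
  exact h5.hasFDerivAt

theorem contDiffAt_chartMul_left {x : E} (hx : x ∈ (extChartAt I (1 : G)).target) :
    ContDiffAt ℝ ∞ (chartMul I G) (x, extChartAt I (1 : G) 1) := by
  refine contDiffAt_chartMul hx (mem_extChartAt_target _) ?_
  rw [extChartAt_to_inv, mul_one, ← extChartAt_source I]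
  exact (extChartAt I (1 : G)).map_target hx

theorem contDiffAt_chartMul_right {x : E} (hx : x ∈ (extChartAt I (1 : G)).target) :
    ContDiffAt ℝ ∞ (chartMul I G) (extChartAt I (1 : G) 1, x) := by
  refine contDiffAt_chartMul (mem_extChartAt_target _) hx ?_
  rw [extChartAt_to_inv, one_mul, ← extChartAt_source I]
  exact (extChartAt I (1 : G)).map_target hx

theorem fderiv_chartMul_left {x : E} (hx : x ∈ (extChartAt I (1 : G)).target) (v : E) :
    fderiv ℝ (chartMul I G) (x, extChartAt I (1 : G) 1) (0, v) =
      (mfderiv I 𝓘(ℝ, E) (extChartAt I (1 : G)) ((extChartAt I (1 : G)).symm x)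
        (mulInvariantVectorField (v : GroupLieAlgebra I G) ((extChartAt I (1 : G)).symm x)) : E) := by
  have hs : (extChartAt I (1 : G)).symm x ∈ (chartAt H (1 : G)).source := by
    rw [← extChartAt_source I]
    exact (extChartAt I (1 : G)).map_target hx
  have h1 := hasFDerivAt_chart_comp (I := I) (mdiff_mul_left ((extChartAt I (1 : G)).symm x) 1)
    (mul_one _) hs
  have h2 := ((contDiffAt_chartMul_left hx).differentiableAt (by simp)).hasFDerivAt.comp
    (f := fun y : E => (x, y)) _ (hasFDerivAt_prodMk_right x (extChartAt I (1 : G) 1))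
  exact congrArg (fun L : E →L[ℝ] E => L v) (h2.unique h1)

theorem fderiv_chartMul_right {x : E} (hx : x ∈ (extChartAt I (1 : G)).target) (v : E) :
    fderiv ℝ (chartMul I G) (extChartAt I (1 : G) 1, x) (v, 0) =
      (mfderiv I 𝓘(ℝ, E) (extChartAt I (1 : G)) ((extChartAt I (1 : G)).symm x)
        (mfderiv I I (fun y : G => y * (extChartAt I (1 : G)).symm x) 1 v : E) : E) := by
  have hs : (extChartAt I (1 : G)).symm x ∈ (chartAt H (1 : G)).source := by
    rw [← extChartAt_source I]
    exact (extChartAt I (1 : G)).map_target hx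
  have h1 := hasFDerivAt_chart_comp (I := I) (mdiff_mul_right ((extChartAt I (1 : G)).symm x) 1)
    (one_mul _) hs
  have h2 := ((contDiffAt_chartMul_right hx).differentiableAt (by simp)).hasFDerivAt.comp
    (f := fun y : E => (y, x)) _ (hasFDerivAt_prodMk_left (extChartAt I (1 : G) 1) x)
  exact congrArg (fun L : E →L[ℝ] E => L v) (h2.unique h1)

/-- The left invariant field of `v`, in the chart at `1`, is the partial derivative of the product in its
second argument at the neutral element. -/
theorem mpullbackWithin_mulInvariantVectorField {x : E} (hx : x ∈ (extChartAt I (1 : G)).target)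
    (v : E) :
    mpullbackWithin 𝓘(ℝ, E) I (extChartAt I (1 : G)).symm
      (mulInvariantVectorField (v : GroupLieAlgebra I G)) (range I) x =
    fderiv ℝ (chartMul I G) (x, extChartAt I (1 : G) 1) (0, v) := by
  rw [fderiv_chartMul_left hx, mpullbackWithin_apply,
    ContinuousLinearMap.inverse_eq (mfderivWithin_extChartAt_symm_comp_mfderiv_extChartAt hx)
      (mfderiv_extChartAt_comp_mfderivWithin_extChartAt_symm hx)]
  rfl

theorem hasFDerivAt_adInv_comp_symm (v : E) :
    HasFDerivAt (adInv I v ∘ (extChartAt I (1 : G)).symm)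
      (mfderiv I 𝓘(ℝ, E) (adInv (E := E) I v : G → E) 1 : E →L[ℝ] E) (extChartAt I (1 : G) 1) := by
  have h1 : ∀ b : G, b = 1 → HasMFDerivAt I 𝓘(ℝ, E) (adInv (E := E) I v : G → E) b
      (mfderiv I 𝓘(ℝ, E) (adInv (E := E) I v : G → E) 1 : E →L[ℝ] E) := by
    rintro b rfl
    exact ((contMDiff_adInv (I := I) (G := G) v).mdifferentiableAt (by simp)).hasMFDerivAt
  have h2 := (h1 ((extChartAt I (1 : G)).symm (extChartAt I (1 : G) 1))
    (extChartAt_to_inv (1 : G))).comp (extChartAt I (1 : G) 1)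
    (hasMFDerivAt_extChartAt_symm_self (I := I) (1 : G))
  exact h2.hasFDerivAt

theorem fderiv_chartMul_one (v : E) :
    fderiv ℝ (chartMul I G) (extChartAt I (1 : G) 1, extChartAt I (1 : G) 1) (0, v) = v := by
  have h : ∀ b : G, b = 1 → (mfderiv I 𝓘(ℝ, E) (extChartAt I (1 : G)) b
      (mulInvariantVectorField (v : GroupLieAlgebra I G) b) : E) = v := by
    rintro b rfl
    exact (congrArg (fun L : E →L[ℝ] E => L _) mfderiv_extChartAt_self).trans
      (mulInvariantVectorField_one (I := I) (G := G) v)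
  exact (fderiv_chartMul_left (mem_extChartAt_target (1 : G)) v).trans
    (h _ (extChartAt_to_inv (1 : G)))

theorem lie_eq_lieBracket_chartMul (v w : E) :
    (Bracket.bracket (L := GroupLieAlgebra I G) (M := GroupLieAlgebra I G) v w : E) = lieBracket ℝ
      (fun x => fderiv ℝ (chartMul I G) (x, extChartAt I (1 : G) 1) (0, v))
      (fun x => fderiv ℝ (chartMul I G) (x, extChartAt I (1 : G) 1) (0, w))
      (extChartAt I (1 : G) 1) := by
  have hev : ∀ u : E, (fun x : E => (mpullbackWithin 𝓘(ℝ, E) I (extChartAt I (1 : G)).symm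
      (mulInvariantVectorField (u : GroupLieAlgebra I G)) (range I) x : E))
      =ᶠ[𝓝 (extChartAt I (1 : G) 1)]
      fun x => fderiv ℝ (chartMul I G) (x, extChartAt I (1 : G) 1) (0, u) := by
    intro u
    filter_upwards [extChartAt_target_mem_nhds (I := I) (1 : G)] with x hx
    exact mpullbackWithin_mulInvariantVectorField hx u
  have h := (hev v).lieBracketWithin_vectorField_eq_nhds (hev w) (𝕜 := ℝ) (s := univ)
  rw [lieBracketWithin_univ (V := fun x => fderiv ℝ (chartMul I G) (x, extChartAt I (1 : G) 1) (0, v))] at h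
  have hinv : ((mfderiv I 𝓘(ℝ, E) (extChartAt I (1 : G)) 1 : E →L[ℝ] E).inverse : E →L[ℝ] E) =
      ContinuousLinearMap.id ℝ E :=
    (congrArg (fun L : E →L[ℝ] E => L.inverse) mfderiv_extChartAt_self).trans
      ContinuousLinearMap.inverse_id
  have hset : (extChartAt I (1 : G)).symm ⁻¹' univ ∩ range I = univ := by
    rw [preimage_univ, univ_inter, I.range_eq_univ]
  have hdef := mlieBracketWithin_apply (I := I) (x₀ := (1 : G)) (s := univ)
    (V := mulInvariantVectorField (v : GroupLieAlgebra I G))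
    (W := mulInvariantVectorField (w : GroupLieAlgebra I G))
  rw [mlieBracketWithin_univ, hset] at hdef
  exact hdef.trans ((congrArg (fun L : E →L[ℝ] E => L _) hinv).trans h)

/-- The bracket `⁅v, w⁆` is the derivative at `1` in the direction `w` of `a ↦ Ad_{a⁻¹} v`. -/
theorem lie_eq_mfderiv_adInv (v w : E) :
    (Bracket.bracket (L := GroupLieAlgebra I G) (M := GroupLieAlgebra I G) v w : E) =
      (mfderiv I 𝓘(ℝ, E) (adInv (E := E) I v : G → E) 1 w : E) := by
  have hA := hasFDerivAt_adInv_comp_symm (I := I) (G := G) v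
  have hA1 : (adInv I v ∘ (extChartAt I (1 : G)).symm) (extChartAt I (1 : G) 1) = v := by
    rw [Function.comp, extChartAt_to_inv]
    exact adInv_one (E := E) v
  have key := lieBracket_eq_fderiv_of_translation (F := chartMul I G)
    (e := extChartAt I (1 : G) 1)
    ((contDiffAt_chartMul_left (mem_extChartAt_target 1)).of_le (by norm_cast))
    fderiv_chartMul_one hA.differentiableAt ?_ w
  · rw [hA1] at key
    exact ((lie_eq_lieBracket_chartMul v w).trans key).trans
      (congrArg (fun L : E →L[ℝ] E => L w) (HasFDerivAt.fderiv hA))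
  · filter_upwards [extChartAt_target_mem_nhds (I := I) (1 : G)] with x hx
    rw [hA1]
    refine (fderiv_chartMul_right hx v).trans (Eq.trans ?_ (fderiv_chartMul_left hx _).symm)
    exact congrArg (mfderiv I 𝓘(ℝ, E) (extChartAt I (1 : G)) ((extChartAt I (1 : G)).symm x))
      (mulInvariantVectorField_adInv v ((extChartAt I (1 : G)).symm x)).symm

end Bracket

/-! ### Bi-invariant metrics and commutativity -/

section BiInvariant

variable {E : Type*} [NormedAddCommGroup E] [NormedSpace ℝ E]
  {H : Type*} [TopologicalSpace H] {I : ModelWithCorners ℝ E H}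
  {G : Type*} [TopologicalSpace G] [ChartedSpace H G] [Group G] [LieGroup I ∞ G]

/-- The adjoint action preserves the inner product on `T_1 G` given by a bi-invariant metric. -/
theorem inner_adInv {g : SmoothMetric I G} (hg : IsBiInvariantMetric g) (v w : E) (a : G) :
    (g.inner 1 : E →L[ℝ] E →L[ℝ] ℝ) (adInv (E := E) I v a) (adInv (E := E) I w a) =
      (g.inner 1 : E →L[ℝ] E →L[ℝ] ℝ) v w := by
  have h1 := inner_mulInvariantVectorField hg.1 (I := I) (adInv (E := E) I v a)
    (adInv (E := E) I w a) a
  have h2 := hg.2 a 1 v w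
  rw [one_mul] at h2
  have h3 : (g.inner a : E →L[ℝ] E →L[ℝ] ℝ)
      (mulInvariantVectorField (I := I) (adInv (E := E) I v a : GroupLieAlgebra I G) a : E)
      (mulInvariantVectorField (I := I) (adInv (E := E) I w a : GroupLieAlgebra I G) a : E) =
      (g.inner a : E →L[ℝ] E →L[ℝ] ℝ) (mfderiv I I (fun x : G => x * a) 1 v : E)
      (mfderiv I I (fun x : G => x * a) 1 w : E) := by
    rw [mulInvariantVectorField_adInv, mulInvariantVectorField_adInv]
  exact h1.symm.trans (h3.trans h2)

/-- The tangent functor takes pointwise products of maps into `G` to pointwise products in `TG`. -/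
theorem tangentMap_mul {f k : G → G} (hf : MDifferentiable I I f) (hk : MDifferentiable I I k)
    (p : TangentBundle I G) :
    tangentMap I I (fun x => f x * k x) p = tangentMap I I f p * tangentMap I I k p := by
  obtain ⟨a, u⟩ := p
  have hm : MDifferentiableAt (I.prod I) I (fun z : G × G => z.1 * z.2) (f a, k a) :=
    (contMDiff_mul I ∞).mdifferentiableAt (by simp)
  have hc := congrArg (fun L : E →L[ℝ] E => L u) (mfderiv_comp a hm ((hf a).prodMk (hk a)))
  have hp : mfderiv I (I.prod I) (fun x : G => (f x, k x)) a =
      (mfderiv I I f a).prod (mfderiv I I k a) :=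
    mfderiv_prodMk (hf a) (hk a)
  rw [hp] at hc
  rw [tangent_mul_eq]
  exact tangentBundle_mk_congr rfl _ _ hc

omit [Group G] [LieGroup I ∞ G] in
theorem tangentMap_const_eq_zeroVec (a : G) (p : TangentBundle I G) :
    tangentMap I I (fun _ : G => a) p = zeroVec I a := by
  refine tangentBundle_mk_congr rfl _ _ ?_
  rw [mfderiv_const]
  rfl

/-- If `Ad` is trivial, then `T_1 G` commutes in `TG` with all zero vectors. The tangent map of
`y ↦ a y a⁻¹ y⁻¹` is the commutator with `0_a` in `TG`, hence takes values in the zero vectors. -/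
theorem mfderiv_commutator_eq_zero (h : ∀ (v : E) (a : G), adInv I v a = v) (a x : G) :
    mfderiv I I (fun y : G => a * y * a⁻¹ * y⁻¹) x = 0 := by
  ext u
  have hid : MDifferentiable I I (fun y : G => y) := mdifferentiable_id
  have hinv : MDifferentiable I I (fun y : G => y⁻¹) :=
    (contMDiff_inv I ∞).mdifferentiable (by simp)
  have hc : ∀ b : G, MDifferentiable I I (fun _ : G => b) := fun b => mdifferentiable_const
  have hmul : ∀ {f k : G → G}, MDifferentiable I I f → MDifferentiable I I k →
      MDifferentiable I I (fun y => f y * k y) := fun hf hk =>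
    ((contMDiff_mul I ∞).mdifferentiable (by simp)).comp (hf.prodMk hk)
  set p : TangentBundle I G := ⟨x, u⟩ with hp
  have h1 : tangentMap I I (fun y : G => a * y * a⁻¹ * y⁻¹) p =
      zeroVec I a * p * zeroVec I a⁻¹ * p⁻¹ := by
    rw [tangentMap_mul (hmul (hmul (hc a) hid) (hc a⁻¹)) hinv,
      tangentMap_mul (hmul (hc a) hid) (hc a⁻¹), tangentMap_mul (hc a) hid,
      tangentMap_const_eq_zeroVec, tangentMap_const_eq_zeroVec]
    congr 3
    exact congrFun tangentMap_id p
  set w : E := maurerCartan I x u with hw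
  have h2 : p = zeroVec I x * (⟨1, w⟩ : TangentBundle I G) := by
    refine Eq.trans ?_ (tangent_mul_mk_one _ w).symm
    refine tangentBundle_mk_congr rfl _ _ (Eq.trans ?_ (zero_add (M := E) _).symm)
    exact (mulInvariantVectorField_maurerCartan x u).symm
  have h3 : ∀ b : G, (⟨1, w⟩ : TangentBundle I G) * zeroVec I b =
      zeroVec I b * (⟨1, w⟩ : TangentBundle I G) := by
    intro b
    have h4 := adInvVec_eq (I := I) w b
    rw [h, adInvVec, inv_mul_eq_iff_eq_mul] at h4
    exact h4
  have h5 : tangentMap I I (fun y : G => a * y * a⁻¹ * y⁻¹) p =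
      zeroVec I (a * x * a⁻¹ * x⁻¹) := by
    rw [h1, h2]
    calc _ = zeroVec I a * zeroVec I x * ((⟨1, w⟩ : TangentBundle I G) * zeroVec I a⁻¹) *
          (⟨1, w⟩ : TangentBundle I G)⁻¹ * (zeroVec I x)⁻¹ := by group
      _ = zeroVec I a * zeroVec I x * zeroVec I a⁻¹ * (zeroVec I x)⁻¹ := by
        rw [h3]; group
      _ = _ := by
        rw [zeroVec_mul, zeroVec_mul, zeroVec_mul]
        congr 1
        rw [inv_eq_iff_mul_eq_one, ← zeroVec_mul, mul_inv_cancel]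
        rfl
  exact eq_of_heq (TotalSpace.mk.inj h5).2

variable [I.Boundaryless]

/-- For a bi-invariant metric all maps `ad u` are skew-adjoint: differentiate the invariance of the metric
under `Ad`. -/
theorem inner_lie_add_inner_lie {g : SmoothMetric I G} (hg : IsBiInvariantMetric g)
    (u v w : GroupLieAlgebra I G) : g.inner 1 ⁅v, u⁆ w + g.inner 1 v ⁅w, u⁆ = 0 := by
  set B : E →L[ℝ] E →L[ℝ] ℝ := g.inner 1 with hB
  have hv := hasFDerivAt_adInv_comp_symm (I := I) (G := G) v
  have hw := hasFDerivAt_adInv_comp_symm (I := I) (G := G) w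
  have h1 := (B.hasFDerivAt.comp _ hv).clm_apply hw
  have h2 : HasFDerivAt (fun x : E => B ((adInv I v ∘ (extChartAt I (1 : G)).symm) x)
      ((adInv I w ∘ (extChartAt I (1 : G)).symm) x)) (0 : E →L[ℝ] ℝ) (extChartAt I (1 : G) 1) := by
    have hconst : (fun x : E => B ((adInv I v ∘ (extChartAt I (1 : G)).symm) x)
        ((adInv I w ∘ (extChartAt I (1 : G)).symm) x)) = fun _ => B v w :=
      funext fun x => inner_adInv hg v w _
    rw [hconst]
    exact hasFDerivAt_const _ _
  have h3 : B (adInv I v ((extChartAt I (1 : G)).symm (extChartAt I (1 : G) 1)))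
        (mfderiv I 𝓘(ℝ, E) (adInv (E := E) I w : G → E) 1 u : E) +
      B (mfderiv I 𝓘(ℝ, E) (adInv (E := E) I v : G → E) 1 u : E)
        (adInv I w ((extChartAt I (1 : G)).symm (extChartAt I (1 : G) 1))) = 0 :=
    congrArg (fun L : E →L[ℝ] ℝ => L u) (h1.unique h2)
  rw [extChartAt_to_inv] at h3
  have e1 : adInv I (v : E) (1 : G) = v := adInv_one (E := E) v
  have e2 : adInv I (w : E) (1 : G) = w := adInv_one (E := E) w
  rw [e1, e2, add_comm] at h3
  have h4 := lie_eq_mfderiv_adInv (I := I) (G := G) v u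
  have h5 := lie_eq_mfderiv_adInv (I := I) (G := G) w u
  exact (congrArg₂ (fun a b : E => B a w + B v b) h4 h5).trans h3

/-- A Lie algebra in which all `⁅Z, ⁅X, Y⁆⁆` vanish is abelian if the group has a bi-invariant metric:
`g (⁅v, u⁆, ⁅v, u⁆) = - g (v, ⁅⁅v, u⁆, u⁆) = 0`. -/
theorem lie_eq_zero_of_biInvariant {g : SmoothMetric I G} (hg : IsBiInvariantMetric g)
    (h : ∀ X Y Z : GroupLieAlgebra I G, ⁅Z, ⁅X, Y⁆⁆ = 0) (v u : GroupLieAlgebra I G) :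
    ⁅v, u⁆ = 0 := by
  by_contra hne
  have h1 := inner_lie_add_inner_lie hg u v ⁅v, u⁆
  have h2 : ⁅⁅v, u⁆, u⁆ = 0 := by
    have h3 := h v u u
    rw [GroupLieAlgebra.bracket_def] at h3 ⊢
    rw [mlieBracket_swap_apply, h3, neg_zero]
  rw [h2, map_zero, add_zero] at h1
  exact (g.pos 1 _ hne).ne' h1

/-- If the Lie algebra is abelian, the derivative of `a ↦ Ad_{a⁻¹} v` vanishes at `1`, hence everywhere by
`adInv_mul`. -/
theorem adInv_eq_self [ConnectedSpace G] (h : ∀ v w : GroupLieAlgebra I G, ⁅v, w⁆ = 0)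
    (v : E) (a : G) : adInv I v a = v := by
  -- The base point equals the one wanted only propositionally, so it is generalized and substituted.
  have key : ∀ (c : E) (b : G), b = 1 →
      (mfderiv I 𝓘(ℝ, E) (adInv (E := E) I c : G → E) b : E →L[ℝ] E) = 0 := by
    rintro c b rfl
    ext w
    exact (lie_eq_mfderiv_adInv c w).symm.trans (h c w)
  refine (eq_of_mfderiv_eq_zero (I := I) (J := 𝓘(ℝ, E)) (f := (adInv (E := E) I v : G → E))
    ((contMDiff_adInv v).mdifferentiable (by simp)) ?_ a 1).trans (adInv_one v)
  intro x
  have hcomp : (adInv (E := E) I v : G → E) = adInv I (adInv I v x) ∘ fun y => x⁻¹ * y := by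
    funext y
    rw [Function.comp, ← adInv_mul, mul_inv_cancel_left]
  have hd : MDifferentiableAt I 𝓘(ℝ, E) (adInv (E := E) I (adInv (E := E) I v x) : G → E)
      (x⁻¹ * x) := (contMDiff_adInv _).mdifferentiableAt (by simp)
  have h1 := mfderiv_comp x hd (mdiff_mul_left (I := I) x⁻¹ x)
  rw [hcomp]
  refine h1.trans ?_
  ext u
  exact congrArg (fun L : E →L[ℝ] E => L (mfderiv I I (fun y : G => x⁻¹ * y) x u : E))
    (key (adInv I v x) _ (inv_mul_cancel x))

/-- A connected Lie group with abelian Lie algebra is abelian. -/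
theorem mul_comm_of_lie_eq_zero [ConnectedSpace G]
    (h : ∀ v w : GroupLieAlgebra I G, ⁅v, w⁆ = 0) (a b : G) : a * b = b * a := by
  have hd : MDifferentiable I I (fun y : G => a * y * a⁻¹ * y⁻¹) :=
    (((contMDiff_const.mul contMDiff_id).mul contMDiff_const).mul
      (contMDiff_inv I ∞)).mdifferentiable (by simp)
  have h1 := eq_of_mfderiv_eq_zero hd (mfderiv_commutator_eq_zero (adInv_eq_self h) a) b 1
  simp only [mul_one, mul_inv_cancel, inv_one] at h1
  rw [mul_inv_eq_one, mul_inv_eq_iff_eq_mul] at h1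
  exact h1

end BiInvariant

/-! ### The lifted metric -/

section Lift

variable {E : Type*} [NormedAddCommGroup E] [NormedSpace ℝ E]
  {H : Type*} [TopologicalSpace H] {I : ModelWithCorners ℝ E H}
  {G : Type*} [TopologicalSpace G] [ChartedSpace H G] [Group G] [LieGroup I ∞ G]

omit [LieGroup I ∞ G] in
theorem tangentBundle_mul_comm (h : ∀ a b : G, a * b = b * a) (p q : TangentBundle I G) :
    p * q = q * p := by
  rw [tangent_mul_def, tangent_mul_def]
  refine tangentBundle_mk_congr (E := E) (I := I) (h _ _) _ _ ?_
  have h1 : (fun x : G => p.proj * x) = fun x => x * p.proj := funext fun x => h _ _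
  have h2 : (fun x : G => x * q.proj) = fun x => q.proj * x := funext fun x => h _ _
  rw [h1, h2]
  exact add_comm (G := E) _ _

section Form

variable {B₁ B₂ : E →L[ℝ] E →L[ℝ] ℝ}

/-- The orthogonal sum on `E × E` of two bilinear forms on `E`. -/
noncomputable def liftForm (B₁ B₂ : E →L[ℝ] E →L[ℝ] ℝ) : E × E →L[ℝ] E × E →L[ℝ] ℝ :=
  B₁.bilinearComp (.fst ℝ E E) (.fst ℝ E E) + B₂.bilinearComp (.snd ℝ E E) (.snd ℝ E E)

theorem liftForm_apply (B₁ B₂ : E →L[ℝ] E →L[ℝ] ℝ) (u v : E × E) :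
    liftForm B₁ B₂ u v = B₁ u.1 v.1 + B₂ u.2 v.2 := rfl

theorem liftForm_symm (h₁ : ∀ u v, B₁ u v = B₁ v u) (h₂ : ∀ u v, B₂ u v = B₂ v u)
    (u v : E × E) : liftForm B₁ B₂ u v = liftForm B₁ B₂ v u := by
  rw [liftForm_apply, liftForm_apply, h₁, h₂]

theorem apply_self_nonneg_of_pos (h₁ : ∀ v, v ≠ 0 → 0 < B₁ v v) (v : E) : 0 ≤ B₁ v v := by
  by_cases hv : v = 0
  · simp [hv]
  · exact (h₁ v hv).le

theorem liftForm_pos (h₁ : ∀ v, v ≠ 0 → 0 < B₁ v v) (h₂ : ∀ v, v ≠ 0 → 0 < B₂ v v)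
    (v : E × E) (hv : v ≠ 0) : 0 < liftForm B₁ B₂ v v := by
  rw [liftForm_apply]
  by_cases h : v.1 = 0
  · exact add_pos_of_nonneg_of_pos (apply_self_nonneg_of_pos h₁ _)
      (h₂ _ fun h' => hv (Prod.ext h h'))
  · exact add_pos_of_pos_of_nonneg (h₁ _ h) (apply_self_nonneg_of_pos h₂ _)

theorem isVonNBounded_liftForm (h₁ : ∀ v, v ≠ 0 → 0 < B₁ v v) (h₂ : ∀ v, v ≠ 0 → 0 < B₂ v v)
    (hb₁ : Bornology.IsVonNBounded ℝ {v | B₁ v v < 1})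
    (hb₂ : Bornology.IsVonNBounded ℝ {v | B₂ v v < 1}) :
    Bornology.IsVonNBounded ℝ {v | liftForm B₁ B₂ v v < 1} := by
  rw [NormedSpace.isVonNBounded_iff] at hb₁ hb₂ ⊢
  refine (hb₁.prod hb₂).subset fun v hv => ?_
  simp only [mem_ofPred_eq, liftForm_apply, mem_prod] at hv ⊢
  have h1 := apply_self_nonneg_of_pos h₁ v.1
  have h2 := apply_self_nonneg_of_pos h₂ v.2
  exact ⟨by linarith, by linarith⟩

end Form

/-- The inner product of a metric at `1`, as a bilinear form on the model space `E = T_1 G`. -/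
noncomputable def formAtOne (g : SmoothMetric I G) : E →L[ℝ] E →L[ℝ] ℝ := g.inner 1

/-- The left invariant metric on `TG` whose value on `T_1 (TG) = E × E` is the orthogonal sum of the
values of `g₁` and `g₂` on `T_1 G = E`. The first factor is the direction of complete lifts, the second
that of vertical lifts. -/
noncomputable def liftMetric (g₁ g₂ : SmoothMetric I G) :
    SmoothMetric I.tangent (TangentBundle I G) :=
  leftInvariantMetric (liftForm (formAtOne g₁) (formAtOne g₂))
    (liftForm_symm (g₁.symm 1) (g₂.symm 1)) (liftForm_pos (g₁.pos 1) (g₂.pos 1))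
    (isVonNBounded_liftForm (g₁.pos 1) (g₂.pos 1) (g₁.isVonNBounded 1) (g₂.isVonNBounded 1))

theorem inner_liftMetric (g₁ g₂ : SmoothMetric I G) (p : TangentBundle I G) (v w : E × E) :
    (liftMetric g₁ g₂).inner p
      (mulInvariantVectorField (I := I.tangent) (G := TangentBundle I G) v p)
      (mulInvariantVectorField (I := I.tangent) (G := TangentBundle I G) w p) =
    formAtOne g₁ v.1 w.1 + formAtOne g₂ v.2 w.2 :=
  inner_leftInvariantMetric _ _ _ _ _ _ p

variable [CompleteSpace E] [BoundarylessManifold I G] [T2Space G]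

theorem isLiftedMetric_liftMetric {g₁ g₂ : SmoothMetric I G} (hg₁ : IsLeftInvariantMetric g₁)
    (hg₂ : IsLeftInvariantMetric g₂) : IsLiftedMetric g₁ g₂ (liftMetric g₁ g₂) where
  leftInvariant := isLeftInvariantMetric_leftInvariantMetric _ _ _ _
  complete_complete X Y p := by
    rw [completeLift_mulInvariantVectorField, completeLift_mulInvariantVectorField,
      inner_mulInvariantVectorField hg₁]
    refine (inner_liftMetric g₁ g₂ p (X, 0) (Y, 0)).trans ?_
    rw [map_zero, add_zero]
    rfl
  vertical_vertical X Y p := by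
    rw [verticalLift_mulInvariantVectorField, verticalLift_mulInvariantVectorField,
      inner_mulInvariantVectorField hg₂]
    refine (inner_liftMetric g₁ g₂ p (0, X) (0, Y)).trans ?_
    rw [map_zero, zero_add]
    rfl
  complete_vertical X Y p := by
    rw [completeLift_mulInvariantVectorField, verticalLift_mulInvariantVectorField]
    refine (inner_liftMetric g₁ g₂ p (X, 0) (0, Y)).trans ?_
    rw [map_zero, map_zero]
    exact zero_add (0 : ℝ)

theorem IsLiftedMetric.inner_mulInvariantVectorField {g₁ g₂ : SmoothMetric I G}
    {g' : SmoothMetric I.tangent (TangentBundle I G)} (h : IsLiftedMetric g₁ g₂ g')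
    (p : TangentBundle I G) (v w : E × E) :
    g'.inner p
      (mulInvariantVectorField (I := I.tangent) (G := TangentBundle I G) v p)
      (mulInvariantVectorField (I := I.tangent) (G := TangentBundle I G) w p) =
    g₁.inner p.proj (mulInvariantVectorField (v.1 : GroupLieAlgebra I G) p.proj)
      (mulInvariantVectorField (w.1 : GroupLieAlgebra I G) p.proj) +
    g₂.inner p.proj (mulInvariantVectorField (v.2 : GroupLieAlgebra I G) p.proj)
      (mulInvariantVectorField (w.2 : GroupLieAlgebra I G) p.proj) := by
  have hsplit : ∀ u : E × E,
      mulInvariantVectorField (I := I.tangent) (G := TangentBundle I G) u p =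
      completeLift (mulInvariantVectorField (u.1 : GroupLieAlgebra I G)) p +
        verticalLift (mulInvariantVectorField (u.2 : GroupLieAlgebra I G)) p := by
    intro u
    refine Eq.trans ?_ (congrArg₂ (fun a b : E × E => a + b)
      (completeLift_mulInvariantVectorField (I := I) (G := G) u.1 p)
      (verticalLift_mulInvariantVectorField (I := I) (G := G) u.2 p)).symm
    refine Eq.trans ?_ (map_add (mfderiv I.tangent I.tangent
      (fun q : TangentBundle I G => p * q) 1) ((u.1, 0) : E × E) ((0, u.2) : E × E))
    refine congrArg (mfderiv I.tangent I.tangent (fun q : TangentBundle I G => p * q) 1)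
      (a₁ := u) (a₂ := ((u.1, 0) + (0, u.2) : E × E)) ?_
    simp
  rw [hsplit v, hsplit w]
  have h1 := h.complete_complete v.1 w.1 p
  have h2 := h.vertical_vertical v.2 w.2 p
  have h3 := h.complete_vertical v.1 w.2 p
  have h4 := (g'.symm p _ _).trans (h.complete_vertical w.1 v.2 p)
  rw [map_add, map_add]
  refine (congrArg₂ (· + ·) (congrArg₂ (· + ·) h1 h4) (congrArg₂ (· + ·) h3 h2)).trans ?_
  rw [add_zero, zero_add]

theorem IsLiftedMetric.unique {g₁ g₂ : SmoothMetric I G}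
    {g' g'' : SmoothMetric I.tangent (TangentBundle I G)} (h' : IsLiftedMetric g₁ g₂ g')
    (h'' : IsLiftedMetric g₁ g₂ g'') : g' = g'' :=
  smoothMetric_ext_of_mulInvariant fun v w p =>
    (h'.inner_mulInvariantVectorField p v w).trans (h''.inner_mulInvariantVectorField p v w).symm

end Lift

theorem theorem2p10
    {E : Type*} [NormedAddCommGroup E] [NormedSpace ℝ E] [FiniteDimensional ℝ E]
    {H : Type*} [TopologicalSpace H] (I : ModelWithCorners ℝ E H) [I.Boundaryless]
    {G : Type*} [TopologicalSpace G] [T2Space G] [ChartedSpace H G] [Group G] [LieGroup I ∞ G]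
    [ConnectedSpace G] (hG : IsIndecomposableLieGroup I G)
    (g₁ g₂ : SmoothMetric I G)
    (hg₁ : IsBiInvariantMetric g₁) (hg₂ : IsLeftInvariantMetric g₂)
    (h : ∀ X Y Z W : GroupLieAlgebra I G, g₂.inner 1 ⁅Z, ⁅X, Y⁆⁆ W = 0) :
    (∃! g' : SmoothMetric I.tangent (TangentBundle I G), IsLiftedMetric g₁ g₂ g') ∧
    ∀ g' : SmoothMetric I.tangent (TangentBundle I G),
      IsLiftedMetric g₁ g₂ g' → IsBiInvariantMetric g' := by
  have : CompleteSpace E := FiniteDimensional.complete ℝ E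
  have hnil : ∀ X Y Z : GroupLieAlgebra I G, ⁅Z, ⁅X, Y⁆⁆ = 0 := by
    intro X Y Z
    by_contra hne
    exact (g₂.pos 1 _ hne).ne' (h X Y Z _)
  have hcomm := mul_comm_of_lie_eq_zero (lie_eq_zero_of_biInvariant hg₁ hnil)
  exact ⟨⟨liftMetric g₁ g₂, isLiftedMetric_liftMetric hg₁.1 hg₂, fun g' h' =>
      h'.unique (isLiftedMetric_liftMetric hg₁.1 hg₂)⟩,
    fun g' h' => isBiInvariantMetric_of_comm h'.leftInvariant (tangentBundle_mul_comm hcomm)⟩
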